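/- Let $n \geq 3$. For a square matrix $M$ let $\rho(M)$ denote its spectral radius, i.e. the largest absolute value of a complex eigenvalue of $M$, and let $\|M\|$ denote its operator norm with respect to the Euclidean (Hermitian) norm; for the matrices $A$ below, $\|A\|$ equals the largest singular value $\sigma_1(A)$ of $A$. (1) There is a constant $C_n > 0$, depending only on $n$, such that for every $A \in SL(n,\mathbb{R})$ the function $X \mapsto \log\rho(AX)$ is integrable on the orthogonal group $O_n$ and $$\int_{O_n} \log \rho(AX)\, dX \;\geq\; C_n \log \|A\| = C_n \log \sigma_1(A),$$ where $dX$ is the Haar measure on $O_n$ normalized to have total mass $1$. (2) The same holds for the unitary group: there is a constant $C_n' > 0$, depending only on $n$, such that for every $A \in SL(n,\mathbb{C})$ (in particular for every $A \in SL(n,\mathbb{R})$) the function $X \mapsto \log\rho(AX)$ is integrable on $U_n$ and $$\int_{U_n} \log \rho(AX)\, dX \;\geq\; C_n' \log \|A\| = C_n' \log \sigma_1(A),$$ where $dX$ is the Haar probability measure on $U_n$. -/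

import Mathlib

open MeasureTheory

/-- The spectral radius of a complex square matrix: the largest absolute value of an eigenvalue. -/
noncomputable def specRadius {n : ℕ} (M : Matrix (Fin n) (Fin n) ℂ) : ℝ :=
  (spectralRadius ℂ M).toReal

/-- The spectral radius of a real square matrix: the largest absolute value of a complex
eigenvalue. -/
noncomputable def specRadiusReal {n : ℕ} (M : Matrix (Fin n) (Fin n) ℝ) : ℝ :=
  specRadius (M.map Complex.ofReal)

/-- The operator norm with respect to the Euclidean (Hermitian) norm. -/
noncomputable def euclOpNorm {𝕜 : Type*} [RCLike 𝕜] {n : ℕ} (M : Matrix (Fin n) (Fin n) 𝕜) : ℝ :=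
  ‖Matrix.toEuclideanCLM (n := Fin n) (𝕜 := 𝕜) M‖

/-- The largest singular value (Mathlib indexes the singular values from `0`, in decreasing
order). -/
noncomputable def topSingularValue {𝕜 : Type*} [RCLike 𝕜] {n : ℕ}
    (M : Matrix (Fin n) (Fin n) 𝕜) : ℝ :=
  (Matrix.toEuclideanLin M).singularValues 0

/-- `Matrix.unitaryGroup (Fin n) 𝕜` is the orthogonal group for `𝕜 = ℝ` and the unitary group
for `𝕜 = ℂ`. -/
instance unitaryGroupCompactSpace (n : ℕ) (𝕜 : Type*) [RCLike 𝕜] :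
    CompactSpace (Matrix.unitaryGroup (Fin n) 𝕜) := by
  have hc : IsClosed ((Matrix.unitaryGroup (Fin n) 𝕜 : Set (Matrix (Fin n) (Fin n) 𝕜))) :=
    isClosed_unitary
  have hK : IsCompact (Set.univ.pi fun _ : Fin n => Set.univ.pi fun _ : Fin n =>
      Metric.closedBall (0 : 𝕜) 1) :=
    isCompact_univ_pi fun _ => isCompact_univ_pi fun _ => isCompact_closedBall _ _
  refine isCompact_iff_compactSpace.mp (hK.of_isClosed_subset hc ?_)
  intro U hU i _ j _
  simpa using entry_norm_bound_of_unitary hU i j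

instance unitaryGroupMeasurableSpace (n : ℕ) (𝕜 : Type*) [RCLike 𝕜] :
    MeasurableSpace (Matrix.unitaryGroup (Fin n) 𝕜) :=
  borel _

instance unitaryGroupBorelSpace (n : ℕ) (𝕜 : Type*) [RCLike 𝕜] :
    BorelSpace (Matrix.unitaryGroup (Fin n) 𝕜) :=
  ⟨rfl⟩

/-- The normalized Haar measure on the orthogonal group (`𝕜 = ℝ`) or the unitary group
(`𝕜 = ℂ`). -/
noncomputable def haarProb (n : ℕ) (𝕜 : Type*) [RCLike 𝕜] :
    Measure (Matrix.unitaryGroup (Fin n) 𝕜) :=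
  Measure.haarMeasure ⊤

instance haarProb_isHaarMeasure (n : ℕ) (𝕜 : Type*) [RCLike 𝕜] :
    (haarProb n 𝕜).IsHaarMeasure :=
  Measure.isHaarMeasure_haarMeasure _

instance haarProb_isProbabilityMeasure (n : ℕ) (𝕜 : Type*) [RCLike 𝕜] :
    IsProbabilityMeasure (haarProb n 𝕜) :=
  ⟨Measure.haarMeasure_self⟩

/-! Since `|det (A X)| = 1`, the product of the eigenvalues of `A X` has modulus `1`, so `log ρ(A X)
≥ 0` for every `X`. It is then enough to find a set of `X`, of Haar measure independent of `A`, on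
which `log ρ(A X) ≥ (1/2) log ‖A‖`.

Write `A = U D V` with `D = diag(d)`, and let `d i = ‖A‖` be the largest entry. Then `A X` is
conjugate to `D (V X U)`, and the set consists of those `X` for which `V X U` lies within `1 / (10
n)` of the reflection along `e = e_i`. It is a translate of a fixed ball around `1`, so its measure
does not depend on `A`.

For `X` near the reflection, an eigenvector of `D X` with eigenvalue `-ζ d i` is a solution of `X w
= -ζ T w`, where `T = d i • D⁻¹ ≥ 1` fixes `e`. Put `w = e + y` with `y ⊥ e`. The component
orthogonal to `e` is a linear equation `(ζ T + Y) y = c`, with `Y` the compression of `X` and `c`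
small. The sign flip of the reflection makes `Y` close to `1`, so `ζ T + Y` is coercive for `Re ζ ≥
0` however large `T` is. The component along `e` becomes a contraction in `ζ` near `1`
(`exists_near_reflection`).

A bound such as `|ζ| ≥ 1/2` would not suffice when `‖A‖` is close to `1`. For `T = 1` the number
`-ζ₀` is an eigenvalue of an isometry, so `|ζ₀| = 1`; comparing `ζ` with `ζ₀` gives `|ζ| ≥ 1 - (δ/2)
min(κ, 1)`, where `κ` bounds `‖T - 1‖` (`exists_near_reflection_norm_ge`). As `∏ d = 1`, one may
take `κ = ‖A‖ ^ n - 1`, and then the loss is at most half of `log ‖A‖` (`half_log_le_log_mul`). -/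

section NearReflection

/-! ### Coercive linear equations, with bounds uniform in `T`. -/

variable {𝕜 E : Type*} [RCLike 𝕜] [NormedAddCommGroup E] [InnerProductSpace 𝕜 E]

lemma norm_le_of_coercive {N : E →ₗ[𝕜] E}
    (hN : ∀ w, 1 / 2 * ‖w‖ ^ 2 ≤ RCLike.re (inner 𝕜 (N w) w)) (w : E) : ‖w‖ ≤ 2 * ‖N w‖ := by
  have h1 : RCLike.re (inner 𝕜 (N w) w) ≤ ‖N w‖ * ‖w‖ := re_inner_le_norm _ _
  have h2 := hN w
  rcases (norm_nonneg w).eq_or_lt with h | h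
  · rw [← h]; positivity
  · nlinarith

lemma surjective_of_coercive [FiniteDimensional 𝕜 E] {N : E →ₗ[𝕜] E}
    (hN : ∀ w, 1 / 2 * ‖w‖ ^ 2 ≤ RCLike.re (inner 𝕜 (N w) w)) : Function.Surjective N := by
  refine LinearMap.surjective_of_injective ((injective_iff_map_eq_zero N).2 fun w hw => ?_)
  have := norm_le_of_coercive hN w
  rw [hw] at this
  simpa using this

/-- Symmetry makes `⟨T w, w⟩` real, so only `Re ζ` meets it and the `T` term contributes a
nonnegative amount. The constant does not depend on the size of `T`. -/
lemma coercive_smul_add {T Y : E →ₗ[𝕜] E} (hTs : T.IsSymmetric)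
    (hTp : ∀ w, 0 ≤ RCLike.re (inner 𝕜 (T w) w))
    (hY : ∀ w, 1 / 2 * ‖w‖ ^ 2 ≤ RCLike.re (inner 𝕜 (Y w) w)) {ζ : 𝕜} (hζ : 0 ≤ RCLike.re ζ)
    (w : E) : 1 / 2 * ‖w‖ ^ 2 ≤ RCLike.re (inner 𝕜 ((ζ • T + Y) w) w) := by
  have h : RCLike.im (inner 𝕜 (T w) w) = 0 := hTs.im_inner_apply_self w
  have h2 : RCLike.re (inner 𝕜 ((ζ • T + Y) w) w) =
      RCLike.re ζ * RCLike.re (inner 𝕜 (T w) w) + RCLike.re (inner 𝕜 (Y w) w) := by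
    simp [inner_add_left, inner_smul_left, h]
  rw [h2]
  have := mul_nonneg hζ (hTp w)
  linarith [hY w]

/-- Dependence on `ζ` of the solution `y` of `ζ T y + Y y = c`. -/
lemma norm_solution_sub_le {T Y : E →ₗ[𝕜] E} (hTs : T.IsSymmetric)
    (hTp : ∀ w, 0 ≤ RCLike.re (inner 𝕜 (T w) w))
    (hY : ∀ w, 1 / 2 * ‖w‖ ^ 2 ≤ RCLike.re (inner 𝕜 (Y w) w)) (hY2 : ∀ w, ‖Y w‖ ≤ 2 * ‖w‖)
    {ζ ζ' : 𝕜} (hζ : 0 ≤ RCLike.re ζ) (hζ' : 0 ≤ RCLike.re ζ') (hζ'n : 1 / 2 ≤ ‖ζ'‖)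
    {c y y' : E} (hy : (ζ • T + Y) y = c) (hy' : (ζ' • T + Y) y' = c) :
    ‖y - y'‖ ≤ 20 * ‖ζ - ζ'‖ * ‖c‖ := by
  have h1 := norm_le_of_coercive (coercive_smul_add hTs hTp hY hζ) (y - y')
  have h2 := norm_le_of_coercive (coercive_smul_add hTs hTp hY hζ') y'
  rw [hy'] at h2
  have h3 : (ζ • T + Y) (y - y') = -(ζ - ζ') • T y' := by
    rw [map_sub, hy, ← hy']
    simp only [LinearMap.add_apply, LinearMap.smul_apply]
    module
  -- No bound on `T` is available; `T y'` is instead controlled by reading the equation backwards.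
  have h4 : ζ' • T y' = c - Y y' := by
    rw [← hy']; simp
  have h5 : ‖ζ'‖ * ‖T y'‖ ≤ 5 * ‖c‖ := by
    rw [← norm_smul, h4]
    linarith [norm_sub_le c (Y y'), hY2 y']
  have h6 : ‖T y'‖ ≤ 10 * ‖c‖ := by nlinarith [norm_nonneg (T y')]
  rw [h3, norm_smul, norm_neg] at h1
  nlinarith [norm_nonneg (ζ - ζ')]

/-- Dependence on `T` of the solution `y` of `ζ T y + Y y = c`. -/
lemma norm_solution_sub_solution_id_le {T Y : E →ₗ[𝕜] E} (hTs : T.IsSymmetric)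
    (hTp : ∀ w, 0 ≤ RCLike.re (inner 𝕜 (T w) w))
    (hY : ∀ w, 1 / 2 * ‖w‖ ^ 2 ≤ RCLike.re (inner 𝕜 (Y w) w)) {κ : ℝ}
    (hκ : ∀ w, ‖T w - w‖ ≤ κ * ‖w‖) (hκ0 : 0 ≤ κ)
    {ζ : 𝕜} (hζ : 0 ≤ RCLike.re ζ) (hζn : ‖ζ‖ = 1)
    {c y y' : E} (hy : (ζ • T + Y) y = c) (hy' : (ζ • (LinearMap.id : E →ₗ[𝕜] E) + Y) y' = c) :
    ‖y - y'‖ ≤ 4 * min κ 1 * ‖c‖ := by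
  have h1 := norm_le_of_coercive (coercive_smul_add hTs hTp hY hζ) (y - y')
  have h2 := norm_le_of_coercive (coercive_smul_add hTs hTp hY hζ) y
  have h2' := norm_le_of_coercive
    (coercive_smul_add LinearMap.IsSymmetric.id (fun w => inner_self_nonneg) hY hζ) y'
  rw [hy] at h2
  rw [hy'] at h2'
  have h3 : (ζ • T + Y) (y - y') = -ζ • (T y' - y') := by
    rw [map_sub, hy, ← hy']
    simp only [LinearMap.add_apply, LinearMap.smul_apply, LinearMap.id_apply]
    module
  rw [h3, norm_smul, norm_neg, hζn] at h1
  -- For `κ ≤ 1` the perturbation bound is used; otherwise the bounds `2 ‖c‖` on each of `y` and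
  -- `y'` already suffice.
  rcases min_cases κ 1 with ⟨h, -⟩ | ⟨h, -⟩ <;> rw [h]
  · have := hκ y'
    nlinarith [norm_nonneg y']
  · linarith [norm_sub_le y y']

/-- The projection of `X` to the orthogonal complement of `e`, extended by the identity on `e`. -/
noncomputable def compressionAlong (e : E) (X : E →ₗ[𝕜] E) : E →ₗ[𝕜] E :=
  let Q : E →ₗ[𝕜] E := (innerₛₗ 𝕜 e).smulRight e
  (LinearMap.id - Q) ∘ₗ X ∘ₗ (LinearMap.id - Q) + Q

lemma compressionAlong_apply (e : E) (X : E →ₗ[𝕜] E) (w : E) :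
    compressionAlong e X w = X (w - inner 𝕜 e w • e) -
      inner 𝕜 e (X (w - inner 𝕜 e w • e)) • e + inner 𝕜 e w • e := by
  simp [compressionAlong]

lemma norm_sub_inner_smul_sq {e : E} (he : ‖e‖ = 1) (w : E) :
    ‖w - inner 𝕜 e w • e‖ ^ 2 = ‖w‖ ^ 2 - ‖inner 𝕜 e w‖ ^ 2 := by
  rw [norm_sub_sq (𝕜 := 𝕜), inner_smul_right, norm_smul, he, ← inner_conj_symm w e,
    RCLike.mul_conj]
  norm_cast
  ring

lemma norm_sub_inner_smul_le {e : E} (he : ‖e‖ = 1) (w : E) :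
    ‖w - inner 𝕜 e w • e‖ ≤ ‖w‖ := by
  have := norm_sub_inner_smul_sq (𝕜 := 𝕜) he w
  exact le_of_sq_le_sq (by nlinarith [sq_nonneg ‖inner 𝕜 e w‖]) (norm_nonneg _)

lemma norm_inner_le_of_unit {e : E} (he : ‖e‖ = 1) (w : E) : ‖inner 𝕜 e w‖ ≤ ‖w‖ := by
  simpa [he] using norm_inner_le_norm (𝕜 := 𝕜) e w

lemma inner_sub_inner_smul {e : E} (he : ‖e‖ = 1) (w : E) :
    inner 𝕜 e (w - inner 𝕜 e w • e) = 0 := by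
  rw [inner_sub_right, inner_smul_right, inner_self_eq_norm_sq_to_K, he]; simp

lemma norm_compressionAlong_le {e : E} (he : ‖e‖ = 1) {X : E →ₗ[𝕜] E}
    (hX : ∀ w, ‖X w‖ = ‖w‖) (w : E) : ‖compressionAlong e X w‖ ≤ 2 * ‖w‖ := by
  rw [compressionAlong_apply]
  refine (norm_add_le _ _).trans ?_
  have h1 := norm_sub_inner_smul_le (𝕜 := 𝕜) he (X (w - inner 𝕜 e w • e))
  rw [hX] at h1
  have h2 := norm_sub_inner_smul_le (𝕜 := 𝕜) he w
  have h3 : ‖inner 𝕜 e w • e‖ ≤ ‖w‖ := by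
    rw [norm_smul, he, mul_one]; exact norm_inner_le_of_unit he w
  linarith

/-- The cross terms between `e` and its complement vanish: the form is `‖·‖²` along `e` and at least
`(1 - δ) ‖·‖²` on the complement, where `X` is close to `1`. Adding the identity on `e` keeps the
equation on all of `E`. -/
lemma compressionAlong_coercive {e : E} (he : ‖e‖ = 1) {X : E →ₗ[𝕜] E} {δ : ℝ} (hδ : δ ≤ 1 / 2)
    (hX : ∀ w, inner 𝕜 e w = 0 → ‖X w - w‖ ≤ δ * ‖w‖) (w : E) :
    1 / 2 * ‖w‖ ^ 2 ≤ RCLike.re (inner 𝕜 (compressionAlong e X w) w) := by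
  obtain ⟨p, hp⟩ : ∃ p, p = w - inner 𝕜 e w • e := ⟨_, rfl⟩
  have hep : inner 𝕜 e p = 0 := hp ▸ inner_sub_inner_smul he w
  have hpe : inner 𝕜 p e = 0 := inner_eq_zero_symm.1 hep
  have hw : w = p + inner 𝕜 e w • e := by simp [hp]
  have h1 : RCLike.re (inner 𝕜 (compressionAlong e X w) w) =
      RCLike.re (inner 𝕜 (X p) p) + ‖inner 𝕜 e w‖ ^ 2 := by
    rw [compressionAlong_apply, ← hp]
    have h2 : inner 𝕜 (X p - inner 𝕜 e (X p) • e) w = inner 𝕜 (X p) p := by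
      conv_lhs => rw [hw]
      rw [inner_add_right, inner_sub_left, inner_smul_left, hep, inner_smul_right, inner_sub_left,
        inner_smul_left, inner_self_eq_norm_sq_to_K, he, inner_conj_symm]
      simp
    rw [inner_add_left, h2, inner_smul_left, RCLike.conj_mul, map_add]
    norm_cast
  have h3 : RCLike.re (inner 𝕜 (X p) p) = ‖p‖ ^ 2 + RCLike.re (inner 𝕜 (X p - p) p) := by
    rw [inner_sub_left, map_sub (RCLike.re (K := 𝕜)), inner_self_eq_norm_sq]; ring
  have h4 : -(‖X p - p‖ * ‖p‖) ≤ RCLike.re (inner 𝕜 (X p - p) p) :=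
    (abs_le.1 ((RCLike.abs_re_le_norm _).trans (norm_inner_le_norm _ _))).1
  have h5 := hX p hep
  have h6 := norm_sub_inner_smul_sq (𝕜 := 𝕜) he w
  rw [← hp] at h6
  rw [h1, h3]
  have h7 : ‖X p - p‖ * ‖p‖ ≤ 1 / 2 * ‖p‖ ^ 2 := by nlinarith [norm_nonneg p]
  nlinarith [sq_nonneg ‖inner 𝕜 e w‖]

end NearReflection
-- The fixed point `ζ` and its modulus.
section NearReflectionFixedPoint

variable {𝕜 E : Type*} [RCLike 𝕜] [NormedAddCommGroup E] [InnerProductSpace 𝕜 E]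
  [FiniteDimensional 𝕜 E]

/-- An isometry `X` close to the reflection along `e` satisfies `X w = -ζ T w` for some `w ≠ 0`
and some `ζ` close to `1`, where `w = e + y` and `y` solves a coercive linear equation. -/
lemma exists_near_reflection {e : E} (he : ‖e‖ = 1) {X T : E →ₗ[𝕜] E} {δ : ℝ} (hδ0 : 0 ≤ δ)
    (hδ : δ ≤ 1 / 10) (hXi : ∀ w, ‖X w‖ = ‖w‖)
    (hX : ∀ w, ‖X w - (w - (2 * inner 𝕜 e w) • e)‖ ≤ δ * ‖w‖)
    (hTs : T.IsSymmetric) (hTp : ∀ w, 0 ≤ RCLike.re (inner 𝕜 (T w) w)) (hTe : T e = e) :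
    ∃ (ζ : 𝕜) (y : E), ‖ζ - 1‖ ≤ 1 / 2 ∧ inner 𝕜 e y = 0 ∧
      (ζ • T + compressionAlong e X) y = inner 𝕜 e (X e) • e - X e ∧
      ζ = -inner 𝕜 e (X e) - inner 𝕜 e (X y) ∧ X (e + y) = -ζ • T (e + y) := by
  set Y := compressionAlong e X with hYdef
  set c := inner 𝕜 e (X e) • e - X e with hc
  have hee : inner 𝕜 e e = (1 : 𝕜) := by rw [inner_self_eq_norm_sq_to_K, he]; simp
  have hXo : ∀ w, inner 𝕜 e w = 0 → ‖X w - w‖ ≤ δ * ‖w‖ := fun w hw => by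
    simpa [hw] using hX w
  have hY := compressionAlong_coercive he (by linarith) hXo
  have hY2 := norm_compressionAlong_le he hXi
  rw [← hYdef] at hY hY2
  have hXe : ‖X e + e‖ ≤ δ := by
    have := hX e
    rw [hee, he] at this
    convert this using 2
    · module
    · ring
  have hcn : ‖c‖ ≤ δ := by
    have : c = -((X e + e) - inner 𝕜 e (X e + e) • e) := by
      rw [inner_add_right, hee, hc]; module
    rw [this, norm_neg]
    exact (norm_sub_inner_smul_le he _).trans hXe
  have hec : inner 𝕜 e c = 0 := by
    rw [hc, inner_sub_right, inner_smul_right, hee]; ring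
  have hsol : ∀ ζ : 𝕜, 0 ≤ RCLike.re ζ → ∃ y, (ζ • T + Y) y = c := fun ζ hζ =>
    surjective_of_coercive (coercive_smul_add hTs hTp hY hζ) c
  -- Pairing the equation with `e` gives `(ζ + 1) ⟨e, y⟩ = ⟨e, c⟩ = 0`, and `ζ ≠ -1` because `Re ζ ≥
  -- 0`.
  have hperp : ∀ (ζ : 𝕜) y, 0 ≤ RCLike.re ζ → (ζ • T + Y) y = c → inner 𝕜 e y = 0 := by
    intro ζ y hζ hy
    have h1 : inner 𝕜 e ((ζ • T + Y) y) = (ζ + 1) * inner 𝕜 e y := by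
      rw [LinearMap.add_apply, LinearMap.smul_apply, inner_add_right, inner_smul_right, ← hTs e y,
        hTe, hYdef, compressionAlong_apply, inner_add_right, inner_smul_right, hee, inner_sub_right,
        inner_smul_right, hee]
      ring
    rw [hy, hec] at h1
    refine (mul_eq_zero.1 h1.symm).resolve_left fun h => ?_
    have := congrArg RCLike.re h
    simp at this
    linarith
  choose! f hf using hsol
  -- The component of `X (e + y) = -ζ T (e + y)` along `e`, with `y = f ζ` substituted; a fixed
  -- point of `G` solves the whole equation.
  set G : 𝕜 → 𝕜 := fun ζ => -inner 𝕜 e (X e) - inner 𝕜 e (X (f ζ)) with hG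
  have hre : ∀ ζ : 𝕜, ‖ζ - 1‖ ≤ 1 / 2 → 1 / 2 ≤ RCLike.re ζ := fun ζ hζ => by
    have := (RCLike.abs_re_le_norm (ζ - 1)).trans hζ
    rw [map_sub, RCLike.one_re] at this
    linarith [(abs_le.1 this).1]
  have hre0 : ∀ ζ : 𝕜, ‖ζ - 1‖ ≤ 1 / 2 → 0 ≤ RCLike.re ζ := fun ζ hζ => by
    linarith [hre ζ hζ]
  have hinn : ∀ y, inner 𝕜 e y = 0 → ‖inner 𝕜 e (X y)‖ ≤ δ * ‖y‖ := fun y hy => by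
    have : inner 𝕜 e (X y) = inner 𝕜 e (X y - y) := by rw [inner_sub_right, hy, sub_zero]
    rw [this]
    exact (norm_inner_le_of_unit he _).trans (hXo y hy)
  have hfn : ∀ ζ : 𝕜, 0 ≤ RCLike.re ζ → ‖f ζ‖ ≤ 2 * δ := fun ζ hζ => by
    have := norm_le_of_coercive (coercive_smul_add hTs hTp hY hζ) (f ζ)
    rw [hf ζ hζ] at this
    linarith
  have hmaps : Set.MapsTo G (Metric.closedBall 1 (1 / 2)) (Metric.closedBall 1 (1 / 2)) := by
    intro ζ hζ
    rw [mem_closedBall_iff_norm] at hζ ⊢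
    have h0 := hre0 ζ hζ
    have h1 : G ζ - 1 = -inner 𝕜 e (X e + e) - inner 𝕜 e (X (f ζ)) := by
      rw [inner_add_right, hee]; simp only [hG]; ring
    have h2 := hinn _ (hperp ζ _ h0 (hf ζ h0))
    have h3 := hfn ζ h0
    have h4 := (norm_inner_le_of_unit (𝕜 := 𝕜) he (X e + e)).trans hXe
    rw [h1]
    refine (norm_sub_le _ _).trans ?_
    rw [norm_neg]
    nlinarith
  have hlip : ∀ ζ ∈ Metric.closedBall (1 : 𝕜) (1 / 2), ∀ ζ' ∈ Metric.closedBall (1 : 𝕜) (1 / 2),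
      dist (G ζ) (G ζ') ≤ (1 / 2 : NNReal) * dist ζ ζ' := by
    intro ζ hζ ζ' hζ'
    rw [mem_closedBall_iff_norm] at hζ hζ'
    have h0 := hre0 ζ hζ
    have h0' := hre0 ζ' hζ'
    have h1 := norm_solution_sub_le hTs hTp hY hY2 h0 h0'
      ((hre ζ' hζ').trans (RCLike.re_le_norm ζ')) (hf ζ h0) (hf ζ' h0')
    have h2 : inner 𝕜 e (f ζ - f ζ') = 0 := by
      rw [inner_sub_right, hperp ζ _ h0 (hf ζ h0), hperp ζ' _ h0' (hf ζ' h0'), sub_zero]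
    have h3 := hinn _ h2
    have h4 : G ζ - G ζ' = -inner 𝕜 e (X (f ζ - f ζ')) := by
      rw [map_sub, inner_sub_right]; simp only [hG]; ring
    rw [dist_eq_norm, dist_eq_norm, h4, norm_neg]
    refine h3.trans ?_
    push_cast
    -- `20 ‖c‖ ≤ 20 δ ≤ 2`; the further factor `δ ≤ 1 / 10` then makes `G` a contraction.
    have h5 : ‖f ζ - f ζ'‖ ≤ 2 * ‖ζ - ζ'‖ := by nlinarith [norm_nonneg (ζ - ζ')]
    nlinarith [norm_nonneg (ζ - ζ'), norm_nonneg (f ζ - f ζ')]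
  have hcontr : ContractingWith (1 / 2 : NNReal) (hmaps.restrict G _ _) := by
    refine ⟨by rw [div_lt_one] <;> norm_num, LipschitzWith.of_dist_le_mul fun a b => ?_⟩
    exact hlip a a.2 b b.2
  obtain ⟨ζ, hζ, hfix, -⟩ := hcontr.exists_fixedPoint' Metric.isClosed_closedBall.isComplete hmaps
    (x := 1) (by simp) (edist_ne_top _ _)
  rw [mem_closedBall_iff_norm] at hζ
  have h0 := hre0 ζ hζ
  have hfix' : ζ = -inner 𝕜 e (X e) - inner 𝕜 e (X (f ζ)) := hfix.symm
  have hp := hperp ζ _ h0 (hf ζ h0)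
  refine ⟨ζ, f ζ, hζ, hp, hf ζ h0, hfix', ?_⟩
  have h1 := hf ζ h0
  rw [LinearMap.add_apply, LinearMap.smul_apply, hYdef, compressionAlong_apply, hp, zero_smul,
    sub_zero, add_zero, hc] at h1
  have h2 : X (f ζ) = -X e - ζ • T (f ζ) + (inner 𝕜 e (X e) + inner 𝕜 e (X (f ζ))) • e := by
    have h3 : X (f ζ) = inner 𝕜 e (X e) • e - X e - ζ • T (f ζ) + inner 𝕜 e (X (f ζ)) • e := by
      rw [← h1]; abel
    calc X (f ζ) = _ := h3
      _ = _ := by module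
  have h3 : inner 𝕜 e (X e) + inner 𝕜 e (X (f ζ)) = -ζ := by
    conv_rhs => rw [hfix']
    ring
  rw [h3] at h2
  rw [map_add, h2, map_add, hTe]
  module

/-- The key estimate: if `T ≥ 0` fixes `e` and `‖T - 1‖ ≤ κ`, the number `ζ` produced above has
modulus at least `1 - δ / 2 * min κ 1`. -/
lemma exists_near_reflection_norm_ge {e : E} (he : ‖e‖ = 1) {X T : E →ₗ[𝕜] E} {δ : ℝ} (hδ0 : 0 ≤ δ)
    (hδ : δ ≤ 1 / 10) (hXi : ∀ w, ‖X w‖ = ‖w‖)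
    (hX : ∀ w, ‖X w - (w - (2 * inner 𝕜 e w) • e)‖ ≤ δ * ‖w‖)
    (hTs : T.IsSymmetric) (hTp : ∀ w, 0 ≤ RCLike.re (inner 𝕜 (T w) w)) (hTe : T e = e)
    {κ : ℝ} (hκ0 : 0 ≤ κ) (hκ : ∀ w, ‖T w - w‖ ≤ κ * ‖w‖) :
    ∃ (ζ : 𝕜) (w : E), w ≠ 0 ∧ X w = -ζ • T w ∧ 1 - δ / 2 * min κ 1 ≤ ‖ζ‖ := by
  obtain ⟨ζ, y, hζ1, hy, hys, hζ, hev⟩ := exists_near_reflection he hδ0 hδ hXi hX hTs hTp hTe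
  obtain ⟨ζ₀, y₀, hζ₀1, hy₀, hys₀, hζ₀, hev₀⟩ := exists_near_reflection he hδ0 hδ hXi hX
    (T := LinearMap.id) LinearMap.IsSymmetric.id (fun w => inner_self_nonneg) rfl
  have hee : inner 𝕜 e e = (1 : 𝕜) := by rw [inner_self_eq_norm_sq_to_K, he]; simp
  have hne : ∀ y, inner 𝕜 e y = 0 → e + y ≠ 0 := fun y hy h => by
    have : inner 𝕜 e (e + y) = 1 := by rw [inner_add_right, hee, hy, add_zero]
    rw [h, inner_zero_right] at this
    exact zero_ne_one this
  -- With `T = 1` the vector `e + y₀` is an eigenvector of the isometry `X` for the eigenvalue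
  -- `-ζ₀`.
  have hζ₀n : ‖ζ₀‖ = 1 := by
    have h := hXi (e + y₀)
    rw [hev₀, norm_smul, norm_neg, LinearMap.id_apply] at h
    exact mul_right_cancel₀ (norm_ne_zero_iff.2 (hne y₀ hy₀)) (by rw [h, one_mul])
  have hXo : ∀ w, inner 𝕜 e w = 0 → ‖X w - w‖ ≤ δ * ‖w‖ := fun w hw => by
    simpa [hw] using hX w
  have hY := compressionAlong_coercive he (by linarith) hXo
  have hY2 := norm_compressionAlong_le he hXi
  have hre : ∀ ζ : 𝕜, ‖ζ - 1‖ ≤ 1 / 2 → 0 ≤ RCLike.re ζ := fun ζ hζ => by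
    have := (RCLike.abs_re_le_norm (ζ - 1)).trans hζ
    rw [map_sub, RCLike.one_re] at this
    linarith [(abs_le.1 this).1]
  have hXe : ‖X e + e‖ ≤ δ := by
    have := hX e
    rw [hee, he] at this
    convert this using 2
    · module
    · ring
  have hcn : ‖inner 𝕜 e (X e) • e - X e‖ ≤ δ := by
    have : inner 𝕜 e (X e) • e - X e = -((X e + e) - inner 𝕜 e (X e + e) • e) := by
      rw [inner_add_right, hee]; module
    rw [this, norm_neg]
    exact (norm_sub_inner_smul_le he _).trans hXe
  -- An intermediate solution, with the operator `T` but the parameter `ζ₀`, so that `ζ` and `T` are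
  -- changed one at a time.
  obtain ⟨y₁, hy₁⟩ := surjective_of_coercive (coercive_smul_add hTs hTp hY (hre ζ₀ hζ₀1))
    (inner 𝕜 e (X e) • e - X e)
  have d1 := norm_solution_sub_le hTs hTp hY hY2 (hre ζ hζ1) (hre ζ₀ hζ₀1) (by rw [hζ₀n]; norm_num)
    hys hy₁
  have d2 := norm_solution_sub_solution_id_le hTs hTp hY hκ hκ0 (hre ζ₀ hζ₀1) hζ₀n hy₁ hys₀
  have hsub : inner 𝕜 e (y - y₀) = 0 := by rw [inner_sub_right, hy, hy₀, sub_zero]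
  have d3 : ‖ζ - ζ₀‖ ≤ δ * ‖y - y₀‖ := by
    have h1 : ζ - ζ₀ = -inner 𝕜 e (X (y - y₀)) := by
      rw [hζ, hζ₀, map_sub, inner_sub_right]; ring
    have h2 : inner 𝕜 e (X (y - y₀)) = inner 𝕜 e (X (y - y₀) - (y - y₀)) := by
      rw [inner_sub_right _ _ (y - y₀), hsub, sub_zero]
    rw [h1, h2, norm_neg]
    exact (norm_inner_le_of_unit he _).trans (hXo _ hsub)
  have d4 : ‖y - y₀‖ ≤ ‖y - y₁‖ + ‖y₁ - y₀‖ := norm_sub_le_norm_sub_add_norm_sub _ _ _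
  have hm : 0 ≤ min κ 1 := le_min hκ0 zero_le_one
  have hr := norm_nonneg (ζ - ζ₀)
  have d5 : ‖y - y₁‖ ≤ 2 * ‖ζ - ζ₀‖ := by nlinarith
  have d6 : ‖y₁ - y₀‖ ≤ 4 * min κ 1 * δ := d2.trans (by gcongr)
  -- The bound on `‖y - y₀‖` itself contains `‖ζ - ζ₀‖`, but with total coefficient at most `1 / 5`,
  -- so it is absorbed on the left.
  have d7 : ‖ζ - ζ₀‖ ≤ δ / 2 * min κ 1 := by
    have h1 : δ * ‖y - y₀‖ ≤ δ * (2 * ‖ζ - ζ₀‖ + 4 * min κ 1 * δ) := by gcongr; linarith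
    have h2 : δ * (2 * ‖ζ - ζ₀‖) ≤ 1 / 5 * ‖ζ - ζ₀‖ := by nlinarith
    have h3 : δ * (4 * min κ 1 * δ) ≤ 2 / 5 * (δ * min κ 1) := by
      nlinarith [mul_nonneg hδ0 hm]
    have h4 := mul_nonneg hδ0 hm
    linarith
  refine ⟨ζ, e + y, hne y hy, hev, ?_⟩
  have := norm_sub_norm_le ζ₀ ζ
  rw [hζ₀n, norm_sub_rev] at this
  linarith

/-- With `t = log d`, the claim amounts to `z ≥ exp (-t / 2)`. The deficit of `z` below `1` is
linear in `t` while `n t ≤ 1 / 2`, and is at most `1 / (20 n)` beyond that. -/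
lemma half_log_le_log_mul {n : ℕ} (hn : 0 < n) {d z : ℝ} (hd : 1 ≤ d)
    (hz : 1 - 1 / (10 * n) / 2 * min (d ^ n - 1) 1 ≤ z) : 1 / 2 * Real.log d ≤ Real.log (d * z) := by
  have hn1 : (1 : ℝ) ≤ n := by exact_mod_cast hn
  set t := Real.log d with ht
  have ht0 : 0 ≤ t := Real.log_nonneg hd
  have hdt : d ^ n = Real.exp (n * t) := by
    rw [ht, ← Real.log_pow, Real.exp_log (by positivity)]
  -- The truncation of `t` treats both regimes at once: the deficit is at most `u / 3`, and `exp (-t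
  -- / 2) ≤ exp (-u / 2) ≤ 1 - u / 3` because `0 ≤ u ≤ 1`.
  set u := min t (1 / (2 * n)) with hu
  have hu0 : 0 ≤ u := le_min ht0 (by positivity)
  have hu1 : u ≤ 1 := (min_le_right _ _).trans (by rw [div_le_one] <;> linarith)
  have h1 : 1 / (10 * n) / 2 * min (d ^ n - 1) 1 ≤ u / 3 := by
    rcases le_total t (1 / (2 * n)) with h | h
    · rw [hu, min_eq_left h]
      have hnt : n * t ≤ 1 / 2 := by
        rw [le_div_iff₀ (by positivity)] at h; linarith
      have h2 : d ^ n - 1 ≤ 2 * (n * t) := by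
        rw [hdt]
        have := Real.add_one_le_exp (-(n * t))
        rw [Real.exp_neg] at this
        have h3 : Real.exp (n * t) ≤ 1 / (1 - n * t) := by
          rw [le_div_iff₀ (by linarith)]
          have h4 := Real.exp_pos (n * t)
          calc Real.exp (n * t) * (1 - n * t) ≤ Real.exp (n * t) * (Real.exp (n * t))⁻¹ := by
                gcongr; linarith
            _ = 1 := mul_inv_cancel₀ h4.ne'
        have h5 : 1 / (1 - n * t) ≤ 1 + 2 * (n * t) := by
          rw [div_le_iff₀ (by linarith)]
          have : 0 ≤ n * t := by positivity
          nlinarith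
        linarith
      calc 1 / (10 * n) / 2 * min (d ^ n - 1) 1 ≤ 1 / (10 * n) / 2 * (2 * (n * t)) := by
            gcongr; exact (min_le_left _ _).trans h2
        _ = t / 10 := by field_simp
        _ ≤ t / 3 := by linarith
    · rw [hu, min_eq_right h]
      calc 1 / (10 * n) / 2 * min (d ^ n - 1) 1 ≤ 1 / (10 * n) / 2 * 1 := by
            gcongr; exact min_le_right _ _
        _ = 1 / n / 20 := by field_simp; norm_num
        _ ≤ 1 / n / 6 := by gcongr; norm_num
        _ = _ := by field_simp; norm_num
  have h2 : Real.exp (-(t / 2)) ≤ z := by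
    have h3 : Real.exp (-(t / 2)) ≤ Real.exp (-(u / 2)) := by
      gcongr; exact min_le_left _ _
    have h4 : Real.exp (-(u / 2)) ≤ 1 - u / 3 := by
      rw [Real.exp_neg]
      have h5 := Real.add_one_le_exp (u / 2)
      rw [inv_le_comm₀ (by positivity) (by linarith)]
      refine le_trans ?_ h5
      rw [inv_le_iff_one_le_mul₀ (by linarith)]
      nlinarith
    linarith
  have h3 : Real.exp (t / 2) ≤ d * z := by
    have : d = Real.exp t := by rw [ht, Real.exp_log (by positivity)]
    calc Real.exp (t / 2) = d * Real.exp (-(t / 2)) := by rw [this, ← Real.exp_add]; ring_nf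
      _ ≤ d * z := by gcongr
  rw [← Real.log_exp (1 / 2 * t)]
  refine Real.log_le_log (Real.exp_pos _) ?_
  rw [show 1 / 2 * t = t / 2 by ring]
  exact h3

end NearReflectionFixedPoint
-- The spectral radius: eigenvalues, determinant, measurability.
section SpecRadius

open scoped Matrix.Norms.L2Operator

variable {n : ℕ}

lemma specRadius_le_norm [NeZero n] (M : Matrix (Fin n) (Fin n) ℂ) : specRadius M ≤ ‖M‖ := by
  have h := spectrum.spectralRadius_le_nnnorm (𝕜 := ℂ) M
  exact ENNReal.toReal_mono ENNReal.coe_ne_top h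

lemma norm_le_specRadius [NeZero n] {M : Matrix (Fin n) (Fin n) ℂ} {v : Fin n → ℂ} (hv : v ≠ 0)
    {μ : ℂ} (h : M.mulVec v = μ • v) : ‖μ‖ ≤ specRadius M := by
  have hμ : μ ∈ spectrum ℂ M := by
    rw [← Matrix.spectrum_toLin']
    exact (Module.End.hasEigenvalue_of_hasEigenvector
      ⟨Module.End.mem_eigenspace_iff.2 (by simpa using h), hv⟩).mem_spectrum
  have h1 : (‖μ‖₊ : ENNReal) ≤ spectralRadius ℂ M := by
    rw [spectralRadius]
    exact le_iSup₂ (f := fun k (_ : k ∈ spectrum ℂ M) => (‖k‖₊ : ENNReal)) μ hμ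
  have h2 := spectrum.spectralRadius_le_nnnorm (𝕜 := ℂ) M
  exact ENNReal.toReal_mono (ne_top_of_le_ne_top ENNReal.coe_ne_top h2) h1

lemma norm_multiset_prod_le_pow {𝕜 : Type*} [NormedField 𝕜] {s : Multiset 𝕜} {r : ℝ}
    (h : ∀ μ ∈ s, ‖μ‖ ≤ r) : ‖s.prod‖ ≤ r ^ s.card := by
  induction s using Multiset.induction_on with
  | empty => simp
  | cons a s ih =>
    have ha := h a (Multiset.mem_cons_self a s)
    rw [Multiset.prod_cons, norm_mul, Multiset.card_cons, pow_succ']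
    exact mul_le_mul ha (ih fun μ hμ => h μ (Multiset.mem_cons_of_mem hμ)) (norm_nonneg _)
      ((norm_nonneg a).trans ha)

/-- The determinant is the product of the `n` roots of the characteristic polynomial, so they cannot
all have modulus below `1`. -/
lemma one_le_specRadius [NeZero n] {M : Matrix (Fin n) (Fin n) ℂ} (h : ‖M.det‖ = 1) :
    1 ≤ specRadius M := by
  by_contra! hlt
  have h0 : ∀ μ ∈ M.charpoly.roots, ‖μ‖ ≤ specRadius M := by
    intro μ hμ
    have hμ' : Module.End.HasEigenvalue (Matrix.toLin' M) μ := by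
      rw [Module.End.hasEigenvalue_iff_isRoot_charpoly, Matrix.charpoly_toLin']
      exact Polynomial.isRoot_of_mem_roots hμ
    obtain ⟨v, hv⟩ := hμ'.exists_hasEigenvector
    exact norm_le_specRadius hv.2 (by simpa using hv.apply_eq_smul)
  have hcard : M.charpoly.roots.card = n := by
    rw [← (IsAlgClosed.splits M.charpoly).natDegree_eq_card_roots, Matrix.charpoly_natDegree_eq_dim,
      Fintype.card_fin]
  have h1 := norm_multiset_prod_le_pow h0
  rw [← Matrix.det_eq_prod_roots_charpoly, h, hcard] at h1
  exact absurd h1 (not_le.2 (pow_lt_one₀ ENNReal.toReal_nonneg hlt (NeZero.ne n)))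

/-- By Gelfand's formula the spectral radius is a pointwise limit of the functions `‖M ^ k‖ ^ (1 /
k)`, so its continuity is not needed. -/
lemma measurable_specRadius_comp {α : Type*} [TopologicalSpace α] [MeasurableSpace α]
    [OpensMeasurableSpace α] {f : α → Matrix (Fin n) (Fin n) ℂ} (hf : Continuous f) :
    Measurable fun a => specRadius (f a) := by
  refine ENNReal.measurable_toReal.comp ?_
  refine measurable_of_tendsto_metrizable (f := fun k a => ((‖f a ^ k‖₊ : ENNReal) ^ (1 / k : ℝ)))
    (fun k => ?_) (tendsto_pi_nhds.2 fun a =>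
      spectrum.pow_nnnorm_pow_one_div_tendsto_nhds_spectralRadius (f a))
  have : Continuous fun a => ‖f a ^ k‖₊ := (hf.pow k).nnnorm
  exact (this.measurable.coe_nnreal_ennreal).pow_const _

end SpecRadius

/-! ### Operator norm and singular values. -/

section EuclNorm

open scoped ComplexOrder Matrix.Norms.L2Operator

/-- The upper bound expands `‖T x‖² = ⟨x, T* T x⟩` in an eigenbasis of `T* T`; a top eigenvector of
`T* T` attains it. -/
lemma opNorm_eq_singularValues_zero {𝕜 E : Type*} [RCLike 𝕜] [NormedAddCommGroup E]
    [InnerProductSpace 𝕜 E] [FiniteDimensional 𝕜 E] (hE : 0 < Module.finrank 𝕜 E)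
    (T : E →L[𝕜] E) : ‖T‖ = T.toLinearMap.singularValues 0 := by
  set S : E →ₗ[𝕜] E := T.toLinearMap with hS
  apply le_antisymm
  · refine T.opNorm_le_bound (S.singularValues_nonneg 0) fun x => ?_
    have hsym := S.isSymmetric_adjoint_comp_self
    set b := hsym.eigenvectorBasis rfl
    have h1 : ‖T x‖ ^ 2 = RCLike.re (inner 𝕜 x ((S.adjoint ∘ₗ S) x)) := by
      rw [LinearMap.comp_apply, LinearMap.adjoint_inner_right, inner_self_eq_norm_sq]; rfl
    have h2 : RCLike.re (inner 𝕜 x ((S.adjoint ∘ₗ S) x)) =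
        ∑ i, hsym.eigenvalues rfl i * ‖inner 𝕜 (b i) x‖ ^ 2 := by
      rw [← b.sum_inner_mul_inner, map_sum]
      refine Finset.sum_congr rfl fun i _ => ?_
      have h3 : inner 𝕜 (b i) ((S.adjoint ∘ₗ S) x) =
          (hsym.eigenvalues rfl i : 𝕜) * inner 𝕜 (b i) x := by
        rw [← hsym, hsym.apply_eigenvectorBasis, inner_smul_left, RCLike.conj_ofReal]
      rw [h3, mul_left_comm, ← inner_conj_symm x (b i), RCLike.conj_mul, RCLike.re_ofReal_mul]
      norm_cast
    have h4 : ‖T x‖ ^ 2 ≤ (S.singularValues 0 * ‖x‖) ^ 2 := by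
      rw [h1, h2, mul_pow, ← b.sum_sq_norm_inner_right x, Finset.mul_sum]
      refine Finset.sum_le_sum fun i _ => ?_
      rw [← S.sq_singularValues_fin rfl i]
      gcongr
      · exact S.singularValues_nonneg _
      · exact S.singularValues_antitone (Nat.zero_le _)
    exact le_of_sq_le_sq h4 (mul_nonneg (S.singularValues_nonneg 0) (norm_nonneg _))
  · obtain ⟨v, hv⟩ := (S.hasEigenvalue_adjoint_comp_self_sq_singularValues hE).exists_hasEigenvector
    have h1 : ‖T v‖ ^ 2 = (S.singularValues 0 * ‖v‖) ^ 2 := by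
      have : ‖T v‖ ^ 2 = RCLike.re (inner 𝕜 v ((S.adjoint ∘ₗ S) v)) := by
        rw [LinearMap.comp_apply, LinearMap.adjoint_inner_right, inner_self_eq_norm_sq]; rfl
      rw [this, hv.apply_eq_smul, inner_smul_right, inner_self_eq_norm_sq_to_K]
      norm_cast
      ring
    have h2 := T.le_opNorm v
    have h3 : S.singularValues 0 * ‖v‖ ≤ ‖T v‖ := le_of_sq_le_sq h1.symm.le (norm_nonneg _)
    exact le_of_mul_le_mul_right (h3.trans h2) (norm_pos_iff.2 hv.2)

lemma euclOpNorm_eq_topSingularValue {𝕜 : Type*} [RCLike 𝕜] {n : ℕ} [NeZero n]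
    (M : Matrix (Fin n) (Fin n) 𝕜) : euclOpNorm M = topSingularValue M :=
  opNorm_eq_singularValues_zero (by simpa using NeZero.pos n) _

/-- Diagonalise `A A* = U D² U*`, which is positive definite as `A` is invertible; then `V = D⁻¹ U*
A` is unitary. -/
lemma exists_singular_value_decomposition {𝕜 : Type*} [RCLike 𝕜] {n : ℕ}
    {A : Matrix (Fin n) (Fin n) 𝕜} (hA : IsUnit A) :
    ∃ (U V : Matrix.unitaryGroup (Fin n) 𝕜) (d : Fin n → ℝ), (∀ i, 0 < d i) ∧
      A = U.val * Matrix.diagonal (fun i => (d i : 𝕜)) * V.val := by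
  have hpd : (A * A.conjTranspose).PosDef :=
    Matrix.PosDef.mul_conjTranspose_self A (Matrix.vecMul_injective_of_isUnit hA)
  have hH := hpd.isHermitian
  set U := hH.eigenvectorUnitary
  set d : Fin n → ℝ := fun i => √(hH.eigenvalues i) with hd
  have hd0 : ∀ i, 0 < d i := fun i => Real.sqrt_pos.2 (hpd.eigenvalues_pos i)
  set D : Matrix (Fin n) (Fin n) 𝕜 := Matrix.diagonal (fun i => (d i : 𝕜)) with hD
  set D' : Matrix (Fin n) (Fin n) 𝕜 := Matrix.diagonal (fun i => ((d i)⁻¹ : 𝕜)) with hD'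
  have hDD' : D * D' = 1 := by
    rw [hD, hD', Matrix.diagonal_mul_diagonal, ← Matrix.diagonal_one]
    congr 1; ext i
    exact mul_inv_cancel₀ (by exact_mod_cast (hd0 i).ne')
  have hD'D : D' * D = 1 := mul_eq_one_comm.1 hDD'
  have hspec : A * A.conjTranspose = U.val * (D * D) * star U.val := by
    conv_lhs => rw [hH.spectral_theorem]
    rw [Unitary.conjStarAlgAut_apply, hD, Matrix.diagonal_mul_diagonal]
    congr 3
    ext i
    simp only [Function.comp, hd]
    rw [← RCLike.ofReal_mul, Real.mul_self_sqrt (hpd.eigenvalues_pos i).le]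
  have hUU : star U.val * U.val = 1 := Unitary.coe_star_mul_self U
  have hUU' : U.val * star U.val = 1 := Unitary.coe_mul_star_self U
  have hDs : star D' = D' := by
    rw [hD', Matrix.star_eq_conjTranspose, Matrix.diagonal_conjTranspose]
    congr 1; ext i; simp
  have hV : D' * star U.val * A ∈ Matrix.unitaryGroup (Fin n) 𝕜 := by
    rw [Matrix.mem_unitaryGroup_iff, star_mul, star_mul, star_star, hDs]
    calc D' * star U.val * A * (star A * (U.val * D'))
        = D' * star U.val * (A * A.conjTranspose) * U.val * D' := by
          simp only [mul_assoc, Matrix.star_eq_conjTranspose]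
      _ = D' * (star U.val * U.val) * (D * D) * (star U.val * U.val) * D' := by
          rw [hspec]; simp only [mul_assoc]
      _ = (D' * D) * (D * D') := by rw [hUU]; simp only [mul_assoc, mul_one]
      _ = 1 := by rw [hDD', hD'D, mul_one]
  refine ⟨U, ⟨_, hV⟩, d, hd0, ?_⟩
  calc A = U.val * star U.val * A := by rw [hUU', one_mul]
    _ = U.val * (D * D') * star U.val * A := by rw [hDD', mul_one]
    _ = _ := by simp only [mul_assoc, D]

end EuclNorm
-- From the reflection to the integral bound.
section Reflection

open scoped Matrix.Norms.L2Operator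

variable {𝕜 : Type*} [RCLike 𝕜] {n : ℕ}

lemma norm_coe_unitaryGroup_le [NeZero n] (X : Matrix.unitaryGroup (Fin n) 𝕜) : ‖X.val‖ ≤ 1 :=
  (CStarRing.norm_of_mem_unitary X.2).le

/-- The reflection in the hyperplane orthogonal to the `i`-th basis vector. -/
noncomputable def coordReflection (𝕜 : Type*) [RCLike 𝕜] (i : Fin n) :
    Matrix.unitaryGroup (Fin n) 𝕜 :=
  ⟨Matrix.diagonal fun j => if j = i then -1 else 1, by
    rw [Matrix.mem_unitaryGroup_iff, Matrix.star_eq_conjTranspose, Matrix.diagonal_conjTranspose,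
      Matrix.diagonal_mul_diagonal, ← Matrix.diagonal_one]
    congr 1; ext j; by_cases h : j = i <;> simp [h]⟩

/-- Multiplying by `∏ d = 1` and bounding the other `n - 1` factors by `d i` gives `d i ≤ d i * (d j
* d i ^ (n - 1))`. This controls `‖T - 1‖` by the largest singular value alone. -/
lemma div_le_pow_of_prod_eq_one [NeZero n] {d : Fin n → ℝ} (hd : ∀ j, 0 < d j)
    (hprod : ∏ j, d j = 1) {i : Fin n} (hi : ∀ j, d j ≤ d i) (j : Fin n) :
    d i / d j ≤ d i ^ n := by
  rw [div_le_iff₀ (hd j)]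
  have h1 : ∏ k ∈ Finset.univ.erase j, d k ≤ d i ^ (n - 1) := by
    calc ∏ k ∈ Finset.univ.erase j, d k ≤ ∏ k ∈ Finset.univ.erase j, d i :=
          Finset.prod_le_prod (fun k _ => (hd k).le) fun k _ => hi k
      _ = d i ^ (n - 1) := by simp [Finset.card_erase_of_mem]
  have h2 := Finset.mul_prod_erase Finset.univ d (Finset.mem_univ j)
  rw [hprod] at h2
  have h3 : d i ^ n = d i * d i ^ (n - 1) := by
    rw [← pow_succ', Nat.sub_add_cancel (NeZero.one_le)]
  calc d i = d i * (d j * ∏ k ∈ Finset.univ.erase j, d k) := by rw [h2, mul_one]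
    _ ≤ d i * (d j * d i ^ (n - 1)) := by
        have := hd i; have := hd j; gcongr
    _ = _ := by rw [h3]; ring

lemma one_le_of_prod_eq_one [NeZero n] {d : Fin n → ℝ} (hd : ∀ j, 0 < d j)
    (hprod : ∏ j, d j = 1) {i : Fin n} (hi : ∀ j, d j ≤ d i) : 1 ≤ d i := by
  have h := div_le_pow_of_prod_eq_one hd hprod hi i
  rw [div_self (hd i).ne'] at h
  by_contra! hlt
  exact absurd h (not_le.2 (pow_lt_one₀ (hd i).le hlt (NeZero.ne n)))

lemma exists_eigenvalue_near_reflection [NeZero n] {d : Fin n → ℝ} (hd : ∀ j, 0 < d j)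
    (hprod : ∏ j, d j = 1) {i : Fin n} (hi : ∀ j, d j ≤ d i) (X : Matrix.unitaryGroup (Fin n) 𝕜)
    (hX : ‖X.val - (coordReflection 𝕜 i).val‖ ≤ 1 / (10 * n)) :
    ∃ (μ : 𝕜) (w : Fin n → 𝕜), w ≠ 0 ∧
      (Matrix.diagonal (fun j => (d j : 𝕜)) * X.val).mulVec w = μ • w ∧
      1 / 2 * Real.log (d i) ≤ Real.log ‖μ‖ := by
  have hn1 : (1 : ℝ) ≤ n := by exact_mod_cast NeZero.one_le
  have hd1 := one_le_of_prod_eq_one hd hprod hi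
  set e : EuclideanSpace 𝕜 (Fin n) := EuclideanSpace.single i 1 with he
  have hen : ‖e‖ = 1 := by simp [he]
  have hinner : ∀ w : EuclideanSpace 𝕜 (Fin n), inner 𝕜 e w = w i := fun w => by
    simp [he, EuclideanSpace.inner_single_left]
  set T : EuclideanSpace 𝕜 (Fin n) →ₗ[𝕜] EuclideanSpace 𝕜 (Fin n) :=
    Matrix.toEuclideanLin (Matrix.diagonal fun j => ((d i / d j : ℝ) : 𝕜)) with hT
  have hTa : ∀ w j, T w j = ((d i / d j : ℝ) : 𝕜) * w j := fun w j => by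
    simp [hT, Matrix.toLpLin_apply, Matrix.mulVec_diagonal]
  have hτ0 : ∀ j, 0 ≤ d i / d j := fun j => div_nonneg (hd i).le (hd j).le
  have hτ1 : ∀ j, 1 ≤ d i / d j := fun j => by rw [one_le_div (hd j)]; exact hi j
  have hTs : T.IsSymmetric := fun v w => by
    simp only [PiLp.inner_apply, hTa, RCLike.inner_apply, map_mul, RCLike.conj_ofReal]
    exact Finset.sum_congr rfl fun j _ => by ring
  have hTp : ∀ w, 0 ≤ RCLike.re (inner 𝕜 (T w) w) := fun w => by
    simp only [PiLp.inner_apply, hTa, RCLike.inner_apply, map_mul, RCLike.conj_ofReal, map_sum]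
    refine Finset.sum_nonneg fun j _ => ?_
    rw [mul_left_comm, RCLike.re_ofReal_mul, RCLike.mul_conj]
    refine mul_nonneg (hτ0 j) ?_
    norm_cast
    positivity
  have hTe : T e = e := by
    ext j
    rw [hTa]
    by_cases h : j = i
    · subst h; rw [div_self (hd j).ne']; simp
    · simp [he, h]
  have hκ0 : 0 ≤ d i ^ n - 1 := sub_nonneg.2 (one_le_pow₀ hd1)
  have hκ : ∀ w, ‖T w - w‖ ≤ (d i ^ n - 1) * ‖w‖ := fun w => by
    refine le_of_sq_le_sq ?_ (mul_nonneg hκ0 (norm_nonneg w))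
    rw [mul_pow, EuclideanSpace.norm_sq_eq, EuclideanSpace.norm_sq_eq, Finset.mul_sum]
    refine Finset.sum_le_sum fun j _ => ?_
    have h1 : (T w - w) j = ((d i / d j - 1 : ℝ) : 𝕜) * w j := by
      rw [PiLp.sub_apply, hTa]; push_cast; ring
    rw [h1, norm_mul, mul_pow, RCLike.norm_ofReal, abs_of_nonneg (sub_nonneg.2 (hτ1 j))]
    have := div_le_pow_of_prod_eq_one hd hprod hi j
    have := sub_nonneg.2 (hτ1 j)
    gcongr
  set L : EuclideanSpace 𝕜 (Fin n) →ₗ[𝕜] EuclideanSpace 𝕜 (Fin n) :=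
    Matrix.toEuclideanLin X.val with hL
  have hLi : ∀ w, ‖L w‖ = ‖w‖ := fun w => by
    have h1 : ∀ (Z : Matrix.unitaryGroup (Fin n) 𝕜) v, ‖Matrix.toEuclideanLin Z.val v‖ ≤ ‖v‖ :=
      fun Z v => by
        have := Matrix.l2_opNorm_mulVec Z.val v
        refine this.trans ?_
        exact mul_le_of_le_one_left (norm_nonneg _) (norm_coe_unitaryGroup_le Z)
    refine le_antisymm (h1 X w) ?_
    have h2 := h1 X⁻¹ (L w)
    have h3 : Matrix.toEuclideanLin (X⁻¹).val (L w) = w := by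
      rw [hL, Matrix.toLpLin_apply, Matrix.toLpLin_apply]
      simp
    rwa [h3] at h2
  have hLX : ∀ w, ‖L w - (w - (2 * inner 𝕜 e w) • e)‖ ≤ 1 / (10 * n) * ‖w‖ := fun w => by
    have h1 : L w - (w - (2 * inner 𝕜 e w) • e) =
        Matrix.toEuclideanLin (X.val - (coordReflection 𝕜 i).val) w := by
      rw [map_sub, LinearMap.sub_apply]
      congr 1
      ext j
      rw [hinner]
      by_cases h : j = i
      · subst h
        simp [coordReflection, Matrix.toLpLin_apply, Matrix.mulVec_diagonal, he]; ring
      · simp [coordReflection, Matrix.toLpLin_apply, Matrix.mulVec_diagonal, he, h]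
    rw [h1]
    refine (Matrix.l2_opNorm_mulVec _ w).trans ?_
    gcongr
  obtain ⟨ζ, w, hw, hev, hζ⟩ := exists_near_reflection_norm_ge hen (by positivity)
    (by rw [div_le_div_iff₀] <;> linarith) hLi hLX hTs hTp hTe hκ0 hκ
  -- Multiplying `X w = -ζ T w` by `D` gives this eigenvalue, since `D T = d i`.
  refine ⟨-(ζ * (d i : 𝕜)), WithLp.ofLp w, by simpa using hw, ?_, ?_⟩
  · ext j
    have h1 : (X.val.mulVec (WithLp.ofLp w)) j = -ζ * (((d i / d j : ℝ) : 𝕜) * w j) := by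
      have := congrArg (fun v : EuclideanSpace 𝕜 (Fin n) => v j) hev
      simpa [hTa, hL, Matrix.toLpLin_apply] using this
    rw [← Matrix.mulVec_mulVec, Matrix.mulVec_diagonal, h1, Pi.smul_apply, smul_eq_mul]
    have h2 : (d j : 𝕜) ≠ 0 := by exact_mod_cast (hd j).ne'
    push_cast
    field_simp
  · have h1 : ‖-(ζ * (d i : 𝕜))‖ = d i * ‖ζ‖ := by
      rw [norm_neg, norm_mul, RCLike.norm_ofReal, abs_of_pos (hd i), mul_comm]
    rw [h1]
    exact half_log_le_log_mul (NeZero.pos n) hd1 hζ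

lemma prod_eq_one_of_svd {A : Matrix (Fin n) (Fin n) 𝕜} (hA : ‖A.det‖ = 1)
    {U V : Matrix.unitaryGroup (Fin n) 𝕜} {d : Fin n → ℝ} (hd : ∀ i, 0 < d i)
    (h : A = U.val * Matrix.diagonal (fun i => (d i : 𝕜)) * V.val) : ∏ i, d i = 1 := by
  have hu : ∀ Z : Matrix.unitaryGroup (Fin n) 𝕜, ‖Z.val.det‖ = 1 := fun Z =>
    CStarRing.norm_of_mem_unitary (Matrix.det_of_mem_unitary Z.2)
  rw [h, Matrix.det_mul, Matrix.det_mul, norm_mul, norm_mul, hu, hu, Matrix.det_diagonal,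
    one_mul, mul_one, ← RCLike.ofReal_prod, RCLike.norm_ofReal,
    abs_of_pos (Finset.prod_pos fun i _ => hd i)] at hA
  exact hA

/-- If `‖det A‖ = 1` then, for some unitary `Z`, every unitary `X` close to `Z` is such that `A X`
has an eigenvalue of modulus at least `‖A‖ ^ (1 / 2)`. -/
lemma exists_center_forall_eigenvalue [NeZero n] {A : Matrix (Fin n) (Fin n) 𝕜}
    (hA : ‖A.det‖ = 1) :
    ∃ Z : Matrix.unitaryGroup (Fin n) 𝕜, ∀ X : Matrix.unitaryGroup (Fin n) 𝕜,
      ‖(Z * X).val - 1‖ < 1 / (10 * n) → ∃ (μ : 𝕜) (w : Fin n → 𝕜), w ≠ 0 ∧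
        (A * X.val).mulVec w = μ • w ∧ 1 / 2 * Real.log ‖A‖ ≤ Real.log ‖μ‖ := by
  have hAu : IsUnit A := by
    rw [Matrix.isUnit_iff_isUnit_det, isUnit_iff_ne_zero]
    intro h
    simp [h] at hA
  obtain ⟨U, V, d, hd, hUV⟩ := exists_singular_value_decomposition hAu
  have hprod := prod_eq_one_of_svd hA hd hUV
  obtain ⟨i, hi⟩ := Finite.exists_max d
  have hAn : ‖A‖ ≤ d i := by
    rw [hUV]
    have h1 : ‖Matrix.diagonal (fun i => (d i : 𝕜))‖ ≤ d i := by
      rw [Matrix.l2_opNorm_diagonal]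
      refine (pi_norm_le_iff_of_nonneg (hd i).le).2 fun j => ?_
      rw [RCLike.norm_ofReal, abs_of_pos (hd j)]
      exact hi j
    calc _ ≤ ‖U.val‖ * ‖Matrix.diagonal (fun i => (d i : 𝕜))‖ * ‖V.val‖ :=
          (norm_mul_le _ _).trans (by gcongr; exact norm_mul_le _ _)
      _ ≤ 1 * d i * 1 := by
          have := (hd i).le
          gcongr <;> apply norm_coe_unitaryGroup_le
      _ = d i := by ring
  have hApos : 0 < ‖A‖ := norm_pos_iff.2 hAu.ne_zero
  -- `V X U` is the reflection exactly when `X = V⁻¹ R U⁻¹`. Taking the inverse as `Z` writes the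
  -- neighbourhood as a left translate, so left invariance of Haar measure applies.
  refine ⟨(V⁻¹ * coordReflection 𝕜 i * U⁻¹)⁻¹, fun X hX => ?_⟩
  set R := coordReflection 𝕜 i
  obtain ⟨μ, w, hw, hev, hμ⟩ := exists_eigenvalue_near_reflection hd hprod hi (V * X * U) (by
    have h1 : (V * X * U).val - R.val =
        (R * U⁻¹).val * (((V⁻¹ * R * U⁻¹)⁻¹ * X).val - 1) * U.val := by
      have h2 : (R * U⁻¹) * ((V⁻¹ * R * U⁻¹)⁻¹ * X) * U = V * X * U := by group
      have h3 : (R * U⁻¹) * U = R := by group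
      rw [mul_sub, sub_mul, mul_one, ← Submonoid.coe_mul, ← Submonoid.coe_mul, h2,
        ← Submonoid.coe_mul, h3]
    rw [h1]
    calc _ ≤ ‖(R * U⁻¹).val‖ * ‖((V⁻¹ * R * U⁻¹)⁻¹ * X).val - 1‖ * ‖U.val‖ :=
          (norm_mul_le _ _).trans (by gcongr; exact norm_mul_le _ _)
      _ ≤ 1 * (1 / (10 * n)) * 1 := by
          gcongr
          · apply norm_coe_unitaryGroup_le
          · apply norm_coe_unitaryGroup_le
      _ = _ := by ring)
  refine ⟨μ, U.val.mulVec w, fun h => hw ?_, ?_, ?_⟩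
  · have := congrArg (fun v => (U⁻¹).val.mulVec v) h
    simpa using this
  · have h1 : A * X.val * U.val =
        U.val * (Matrix.diagonal (fun j => (d j : 𝕜)) * (V * X * U).val) := by
      rw [hUV]; simp only [Submonoid.coe_mul, mul_assoc]
    rw [Matrix.mulVec_mulVec, h1, ← Matrix.mulVec_mulVec, hev, Matrix.mulVec_smul]
  · refine le_trans ?_ hμ
    gcongr

/-- The lower bound for any function `ρ` on matrices with the basic properties of the spectral
radius. -/
theorem exists_integral_log_ge [NeZero n] (ρ : Matrix (Fin n) (Fin n) 𝕜 → ℝ)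
    (hmeas : ∀ A : Matrix (Fin n) (Fin n) 𝕜,
      Measurable fun X : Matrix.unitaryGroup (Fin n) 𝕜 => ρ (A * X.val))
    {g : Matrix (Fin n) (Fin n) 𝕜 → ℝ} (hg : Continuous g) (hρg : ∀ M, ρ M ≤ g M)
    (hev : ∀ (M : Matrix (Fin n) (Fin n) 𝕜) (μ : 𝕜) (w : Fin n → 𝕜), w ≠ 0 →
      M.mulVec w = μ • w → ‖μ‖ ≤ ρ M)
    (hdet : ∀ M : Matrix (Fin n) (Fin n) 𝕜, ‖M.det‖ = 1 → 1 ≤ ρ M) :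
    ∃ C : ℝ, 0 < C ∧ ∀ A : Matrix.SpecialLinearGroup (Fin n) 𝕜,
      Integrable (fun X : Matrix.unitaryGroup (Fin n) 𝕜 => Real.log (ρ (A.val * X.val)))
        (haarProb n 𝕜) ∧
      C * Real.log (euclOpNorm A.val) ≤
        ∫ X : Matrix.unitaryGroup (Fin n) 𝕜, Real.log (ρ (A.val * X.val)) ∂(haarProb n 𝕜) := by
  -- The radius depends on `n` only, which makes half the measure of `B` a constant uniform in `A`.
  set B : Set (Matrix.unitaryGroup (Fin n) 𝕜) := {X | ‖X.val - 1‖ < 1 / (10 * n)} with hB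
  have hBo : IsOpen B := isOpen_lt (continuous_subtype_val.sub continuous_const).norm continuous_const
  have hBne : B.Nonempty := ⟨1, by
    have : (0 : ℝ) < n := by exact_mod_cast NeZero.pos n
    simpa [hB] using this⟩
  have hBpos : 0 < (haarProb n 𝕜).real B :=
    ENNReal.toReal_pos (hBo.measure_pos _ hBne).ne' (measure_ne_top _ _)
  refine ⟨(haarProb n 𝕜).real B * (1 / 2), by positivity, fun A => ?_⟩
  have hAdet : ‖A.val.det‖ = 1 := by rw [A.2]; simp
  have h1 : ∀ X : Matrix.unitaryGroup (Fin n) 𝕜, 1 ≤ ρ (A.val * X.val) := fun X => by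
    refine hdet _ ?_
    rw [Matrix.det_mul, norm_mul, hAdet, one_mul]
    exact CStarRing.norm_of_mem_unitary (Matrix.det_of_mem_unitary X.2)
  obtain ⟨K, hK⟩ := (isCompact_range (hg.comp (continuous_const.mul continuous_subtype_val) :
    Continuous fun X : Matrix.unitaryGroup (Fin n) 𝕜 => g (A.val * X.val))).bddAbove
  have hint : Integrable (fun X : Matrix.unitaryGroup (Fin n) 𝕜 => Real.log (ρ (A.val * X.val)))
      (haarProb n 𝕜) := by
    refine Integrable.of_bound (Real.measurable_log.comp (hmeas A.val)).aestronglyMeasurable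
      (Real.log K) (Filter.Eventually.of_forall fun X => ?_)
    rw [Real.norm_of_nonneg (Real.log_nonneg (h1 X))]
    exact Real.log_le_log (by linarith [h1 X]) ((hρg _).trans (hK ⟨X, rfl⟩))
  refine ⟨hint, ?_⟩
  obtain ⟨Z, hZ⟩ := exists_center_forall_eigenvalue hAdet
  have hSm : MeasurableSet ((fun X => Z * X) ⁻¹' B) :=
    (hBo.preimage (continuous_const.mul continuous_id)).measurableSet
  have hSB : (haarProb n 𝕜).real ((fun X => Z * X) ⁻¹' B) = (haarProb n 𝕜).real B := by
    rw [measureReal_def, measure_preimage_mul, measureReal_def]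
  have hlow : ∀ X ∈ (fun X => Z * X) ⁻¹' B,
      1 / 2 * Real.log ‖A.val‖ ≤ Real.log (ρ (A.val * X.val)) := by
    intro X hX
    obtain ⟨μ, w, hw, hμ, hlog⟩ := hZ X hX
    refine hlog.trans ?_
    -- `Real.log` is not monotone at `0`; for `μ = 0` the convention `Real.log 0 = 0` still gives
    -- the inequality.
    rcases (norm_nonneg μ).eq_or_lt with h | h
    · rw [← h, Real.log_zero]
      exact Real.log_nonneg (h1 X)
    · exact Real.log_le_log h (hev _ μ w hw hμ)
  calc (haarProb n 𝕜).real B * (1 / 2) * Real.log (euclOpNorm A.val)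
      = ∫ X in (fun X => Z * X) ⁻¹' B, 1 / 2 * Real.log ‖A.val‖ ∂(haarProb n 𝕜) := by
        rw [setIntegral_const, hSB, smul_eq_mul, mul_assoc]; rfl
    _ ≤ ∫ X in (fun X => Z * X) ⁻¹' B, Real.log (ρ (A.val * X.val)) ∂(haarProb n 𝕜) :=
        setIntegral_mono_on (integrable_const _).integrableOn hint.integrableOn hSm hlow
    _ ≤ _ := setIntegral_le_integral hint
        (Filter.Eventually.of_forall fun X => Real.log_nonneg (h1 X))

end Reflection
-- The unitary and orthogonal cases.
section MainTheorem

open scoped Matrix.Norms.L2Operator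

lemma exists_integral_log_specRadius_ge (n : ℕ) [NeZero n] :
    ∃ C : ℝ, 0 < C ∧ ∀ A : Matrix.SpecialLinearGroup (Fin n) ℂ,
      Integrable (fun X : Matrix.unitaryGroup (Fin n) ℂ =>
        Real.log (specRadius (A.val * X.val))) (haarProb n ℂ) ∧
      C * Real.log (euclOpNorm A.val) ≤
        ∫ X : Matrix.unitaryGroup (Fin n) ℂ,
          Real.log (specRadius (A.val * X.val)) ∂(haarProb n ℂ) :=
  exists_integral_log_ge specRadius
    (fun _ => measurable_specRadius_comp (continuous_const.mul continuous_subtype_val))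
    continuous_norm specRadius_le_norm (fun _ _ _ hw h => norm_le_specRadius hw h)
    (fun _ h => one_le_specRadius h)

/-- Over `ℝ` the fixed point is real, so it gives a real eigenpair, which survives complexification.
The upper bound for the spectral radius is the norm of the complexified matrix. -/
lemma exists_integral_log_specRadiusReal_ge (n : ℕ) [NeZero n] :
    ∃ C : ℝ, 0 < C ∧ ∀ A : Matrix.SpecialLinearGroup (Fin n) ℝ,
      Integrable (fun X : Matrix.orthogonalGroup (Fin n) ℝ =>
        Real.log (specRadiusReal (A.val * X.val))) (haarProb n ℝ) ∧
      C * Real.log (euclOpNorm A.val) ≤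
        ∫ X : Matrix.orthogonalGroup (Fin n) ℝ,
          Real.log (specRadiusReal (A.val * X.val)) ∂(haarProb n ℝ) := by
  have hmap : Continuous fun M : Matrix (Fin n) (Fin n) ℝ => M.map Complex.ofReal :=
    continuous_id.matrix_map Complex.continuous_ofReal
  refine exists_integral_log_ge specRadiusReal
    (fun _ => measurable_specRadius_comp
      (hmap.comp (continuous_const.mul continuous_subtype_val)))
    hmap.norm (fun M => specRadius_le_norm _) (fun M μ w hw h => ?_) (fun M h => ?_)
  · have hw' : (fun j => (w j : ℂ)) ≠ 0 := fun h0 => hw (by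
      ext j; simpa using congrFun h0 j)
    have hev : (M.map Complex.ofReal).mulVec (fun j => (w j : ℂ)) = (μ : ℂ) • fun j => (w j : ℂ) := by
      ext j
      have := congrArg Complex.ofReal (congrFun h j)
      simpa [Matrix.mulVec, dotProduct] using this
    simpa [specRadiusReal] using norm_le_specRadius hw' hev
  · refine one_le_specRadius ?_
    have : (M.map Complex.ofReal).det = (M.det : ℂ) := (Complex.ofRealHom.map_det M).symm
    rw [this, Complex.norm_real, h]

end MainTheorem

theorem mainTheorem2 (n : ℕ) (hn : 3 ≤ n) :
    ((∀ A : Matrix.SpecialLinearGroup (Fin n) ℝ, euclOpNorm A.val = topSingularValue A.val) ∧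
      ∃ C : ℝ, 0 < C ∧ ∀ A : Matrix.SpecialLinearGroup (Fin n) ℝ,
        Integrable (fun X : Matrix.orthogonalGroup (Fin n) ℝ =>
          Real.log (specRadiusReal (A.val * X.val))) (haarProb n ℝ) ∧
        C * Real.log (euclOpNorm A.val) ≤
          ∫ X : Matrix.orthogonalGroup (Fin n) ℝ,
            Real.log (specRadiusReal (A.val * X.val)) ∂(haarProb n ℝ)) ∧
    ((∀ A : Matrix.SpecialLinearGroup (Fin n) ℂ, euclOpNorm A.val = topSingularValue A.val) ∧
      ∃ C : ℝ, 0 < C ∧ ∀ A : Matrix.SpecialLinearGroup (Fin n) ℂ,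
        Integrable (fun X : Matrix.unitaryGroup (Fin n) ℂ =>
          Real.log (specRadius (A.val * X.val))) (haarProb n ℂ) ∧
        C * Real.log (euclOpNorm A.val) ≤
          ∫ X : Matrix.unitaryGroup (Fin n) ℂ,
            Real.log (specRadius (A.val * X.val)) ∂(haarProb n ℂ)) := by
  have : NeZero n := ⟨by omega⟩
  exact ⟨⟨fun _ => euclOpNorm_eq_topSingularValue _, exists_integral_log_specRadiusReal_ge n⟩,
    fun _ => euclOpNorm_eq_topSingularValue _, exists_integral_log_specRadius_ge n⟩
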